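/- Let $G$ be a graph on the vertex set $V=\{0,\dots,n-1\}$, whose edges are called positive and whose non-adjacent pairs of distinct vertices are called negative edges. For a clustering $\ell:V\to\mathbb N$ (the clusters are the sets of vertices with equal label) let $\mathrm{cost}(\ell)$ be the number of negative edges inside clusters plus the number of positive edges between different clusters, and let $\mathrm{OPT}$ be the minimum cost of a clustering of $G$. Algorithm QECC with query budget $Q$ (a positive integer) works as follows. Start with $R=V$. While $R\neq\emptyset$ and $Q\ge |R|-1$: pick a pivot $v\in R$ uniformly at random; query all pairs $\{v,w\}$ with $w\in R\setminus\{v\}$, which reveals whether they are positive; replace $Q$ by $Q-|R|+1$; output the cluster $C=\{v\}\cup\{w\in R: \{v,w\}\text{ is a positive edge}\}$; replace $R$ by $R\setminus C$. When the loop ends, output a singleton cluster for each remaining $v\in R$. Theorem. For every graph $G$ on $n$ vertices and every integer $Q>0$, QECC with budget $Q$ always makes at most $Q$ edge queries, and the clustering that it outputs has expected cost at most $$3\cdot \mathrm{OPT}+\frac{n^3}{2Q}.$$ Moreover QECC runs in time $O(Q)$ with unit-cost queries: there are a constant $C$ and a single program for a random access machine (registers and memory over $\mathbb N$; addition, truncated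 subtraction, comparison, memory access, drawing a uniformly random element of $\{0,\dots,m-1\}$, and an edge query each take one unit of time; $n$ and $Q$ are given in registers, everything else is initially $0$) such that for all $n$, all $Q>0$ and all graphs $G$ on $n$ vertices every run of the program halts within $C\cdot Q$ steps, and the output clustering together with the multiset of queried pairs has the same joint distribution as for QECC. Here the output is the array of labels in memory, in which a vertex whose cell was never written has its own name as its label, and every other vertex is labelled by the pivot of its cluster (so that remaining singletons need not be written out). -/

import Mathlib

open scoped ENNReal

/-! ### Correlation clustering -/

namespace CorrClust

/- The input is the complete graph on `Fin n` with every edge labelled positive or negative. Its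
positive edges form a `SimpleGraph (Fin n)`; the negative edges are the remaining pairs of distinct
vertices. A clustering is a labelling `Fin n → ℕ`; its clusters are the sets of vertices with the
same label. -/

open Classical in
/-- The number of disagreements of the clustering `l` with `G`: negative edges inside clusters plus
positive edges between clusters. -/
noncomputable def cost {n : ℕ} (G : SimpleGraph (Fin n)) (l : Fin n → ℕ) : ℕ :=
  (Finset.univ.filter fun p : Fin n × Fin n =>
      p.1 < p.2 ∧ l p.1 = l p.2 ∧ ¬ G.Adj p.1 p.2).card +
  (Finset.univ.filter fun p : Fin n × Fin n =>
      p.1 < p.2 ∧ l p.1 ≠ l p.2 ∧ G.Adj p.1 p.2).card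

/-- The least cost of a clustering of `G` (a minimum over a nonempty set of natural numbers). -/
noncomputable def opt {n : ℕ} (G : SimpleGraph (Fin n)) : ℕ :=
  ⨅ l : Fin n → ℕ, cost G l

/-- The expectation of a `[0, ∞]`-valued function under a discrete probability distribution. -/
noncomputable def expect {α : Type*} (p : PMF α) (f : α → ℝ≥0∞) : ℝ≥0∞ :=
  ∑' a, p a * f a

/-! ### The algorithm QECC -/

/-- The variables of the algorithm: the unclustered vertices, the remaining query budget, the labels
of the clusters output so far, and the pairs queried so far. -/
structure QState (n : ℕ) where
  R : Finset (Fin n)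
  budget : ℕ
  label : Fin n → ℕ
  queries : Multiset (Sym2 (Fin n))

open Classical in
/-- The cluster `{v} ∪ (Γ⁺(v) ∩ R)`. -/
noncomputable def pivotCluster {n : ℕ} (G : SimpleGraph (Fin n)) (R : Finset (Fin n))
    (v : Fin n) : Finset (Fin n) :=
  insert v (R.filter fun w => G.Adj v w)

/-- The body of the main loop, with the pivot `v`: query all pairs `{v, w}` for `w ∈ R \ {v}`,
pay for these queries, output the cluster of `v` (labelled by `v`), and remove it from `R`. -/
noncomputable def pivotRound {n : ℕ} (G : SimpleGraph (Fin n)) (s : QState n) (v : Fin n) :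
    QState n where
  R := s.R \ pivotCluster G s.R v
  budget := s.budget - (s.R.card - 1)
  label := fun w => if w ∈ pivotCluster G s.R v then (v : ℕ) else s.label w
  queries := s.queries + (s.R.erase v).val.map fun w => s(v, w)

theorem pivotRound_card_lt {n : ℕ} (G : SimpleGraph (Fin n)) (s : QState n) {v : Fin n}
    (hv : v ∈ s.R) : (pivotRound G s v).R.card < s.R.card := by
  apply Finset.card_lt_card
  refine Finset.ssubset_iff_subset_ne.2 ⟨Finset.sdiff_subset, fun h => ?_⟩
  rw [← h] at hv
  exact (Finset.mem_sdiff.1 hv).2 (Finset.mem_insert_self _ _)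

/-- The main loop: while `R ≠ ∅` and the budget is at least `|R| - 1`, pick a pivot in `R`
uniformly at random and process it. -/
noncomputable def qeccLoop {n : ℕ} (G : SimpleGraph (Fin n)) (s : QState n) : PMF (QState n) :=
  if h : s.R.Nonempty ∧ s.R.card - 1 ≤ s.budget then
    (PMF.uniformOfFinset s.R.attach (Finset.attach_nonempty_iff.2 h.1)).bind fun v =>
      qeccLoop G (pivotRound G s v)
  else PMF.pure s
termination_by s.R.card
decreasing_by exact pivotRound_card_lt G s v.2

/-- Algorithm QECC with query budget `Q`: the joint distribution of the clustering that is output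
and of the multiset of the pairs that were queried. The vertices that are unclustered at the end of
the main loop become singletons, each labelled by itself. -/
noncomputable def qecc {n : ℕ} (G : SimpleGraph (Fin n)) (Q : ℕ) :
    PMF ((Fin n → ℕ) × Multiset (Sym2 (Fin n))) :=
  (qeccLoop G { R := Finset.univ, budget := Q, label := fun _ => 0, queries := 0 }).map fun s =>
    (fun v => if v ∈ s.R then (v : ℕ) else s.label v, s.queries)

/-! ### A randomized random access machine with query access to a graph -/

/-- The instructions. Operands are names of registers, except for the constant in `const` and the
jump targets, which are positions in the program. -/
inductive Instr where
  /-- `d := k` -/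
  | const (d k : ℕ)
  /-- `d := a` -/
  | move (d a : ℕ)
  /-- `d := a + b` -/
  | add (d a b : ℕ)
  /-- `d := a - b` (zero if `a < b`) -/
  | sub (d a b : ℕ)
  /-- `d := memory[a]` -/
  | load (d a : ℕ)
  /-- `memory[a] := b` -/
  | store (a b : ℕ)
  /-- continue at `t` -/
  | jump (t : ℕ)
  /-- if `a < b`, continue at `t` -/
  | jumpLt (a b t : ℕ)
  /-- `d :=` a uniformly random element of `{0, …, a - 1}` (zero if `a = 0`) -/
  | rand (d a : ℕ)
  /-- `d := 1` if the pair `{a, b}` is a positive edge, `d := 0` otherwise -/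
  | query (d a b : ℕ)

/-- A configuration: program counter, registers, memory, and the pairs queried so far. -/
structure Config where
  pc : ℕ
  reg : ℕ → ℕ
  mem : ℕ → ℕ
  queries : Multiset (Sym2 ℕ)

/-- Set register `d` to `x` and go to the next instruction. -/
def Config.set (c : Config) (d x : ℕ) : Config :=
  { c with pc := c.pc + 1, reg := Function.update c.reg d x }

/-- The uniform distribution on `{0, …, m - 1}`, and the point mass at zero if `m = 0`. -/
noncomputable def uniformBelow (m : ℕ) : PMF ℕ :=
  if h : m = 0 then PMF.pure 0
  else PMF.uniformOfFinset (Finset.range m) (Finset.nonempty_range_iff.2 h)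

/-- The effect of one instruction. The graph is accessible only through `oracle`. -/
noncomputable def Instr.exec (oracle : ℕ → ℕ → ℕ) (c : Config) : Instr → PMF Config
  | .const d k => PMF.pure (c.set d k)
  | .move d a => PMF.pure (c.set d (c.reg a))
  | .add d a b => PMF.pure (c.set d (c.reg a + c.reg b))
  | .sub d a b => PMF.pure (c.set d (c.reg a - c.reg b))
  | .load d a => PMF.pure (c.set d (c.mem (c.reg a)))
  | .store a b =>
      PMF.pure { c with pc := c.pc + 1, mem := Function.update c.mem (c.reg a) (c.reg b) }
  | .jump t => PMF.pure { c with pc := t }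
  | .jumpLt a b t => PMF.pure { c with pc := if c.reg a < c.reg b then t else c.pc + 1 }
  | .rand d a => (uniformBelow (c.reg a)).map fun x => c.set d x
  | .query d a b =>
      PMF.pure { c.set d (oracle (c.reg a) (c.reg b)) with
        queries := s(c.reg a, c.reg b) ::ₘ c.queries }

/-- The machine has halted when the program counter has left the program. -/
def Halted (P : List Instr) (c : Config) : Prop := P.length ≤ c.pc

/-- One step, which takes one unit of time; a halted machine does not move. -/
noncomputable def step (P : List Instr) (oracle : ℕ → ℕ → ℕ) (c : Config) : PMF Config :=
  match P[c.pc]? with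
  | some i => i.exec oracle c
  | none => PMF.pure c

/-- The distribution of the configuration after `t` steps. -/
noncomputable def run (P : List Instr) (oracle : ℕ → ℕ → ℕ) : ℕ → Config → PMF Config
  | 0, c => PMF.pure c
  | t + 1, c => (step P oracle c).bind (run P oracle t)

open Classical in
/-- Query access to the graph `G`: the answer is `1` on positive edges and `0` on all other
pairs. -/
noncomputable def edgeOracle {n : ℕ} (G : SimpleGraph (Fin n)) (u v : ℕ) : ℕ :=
  if ∃ (hu : u < n) (hv : v < n), G.Adj ⟨u, hu⟩ ⟨v, hv⟩ then 1 else 0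

/-- At the start, register `0` holds `n`, register `1` holds `Q`, and all other registers and all
memory cells hold `0`. -/
def start (n Q : ℕ) : Config where
  pc := 0
  reg := fun i => if i = 0 then n else if i = 1 then Q else 0
  mem := fun _ => 0
  queries := 0

/-- The clustering held in the memory: the vertex `v` has the label `k` if memory cell `v` holds
`k + 1`; if memory cell `v` holds the initial value `0`, then `v` has its own name as its label. -/
def Config.clustering (n : ℕ) (c : Config) : Fin n → ℕ :=
  fun v => if c.mem v = 0 then (v : ℕ) else c.mem v - 1

/-- The program `P` implements QECC in time `T n Q`: on every graph on `n` vertices and with every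
query budget `Q > 0`, all of its runs halt within `T n Q` steps, and the joint distribution of its
output clustering and of the pairs that it queries is the one of QECC. -/
def ImplementsQECC (P : List Instr) (T : ℕ → ℕ → ℕ) : Prop :=
  ∀ (n Q : ℕ), 0 < Q → ∀ G : SimpleGraph (Fin n),
    (∀ c ∈ (run P (edgeOracle G) (T n Q) (start n Q)).support, Halted P c) ∧
    (run P (edgeOracle G) (T n Q) (start n Q)).map (fun c => (c.clustering n, c.queries)) =
      (qecc G Q).map (fun r => (r.1, r.2.map (Sym2.map Fin.val)))

end CorrClust

/-! If `v` is the pivot, then the cluster of `v` disagrees with the graph on a pair `{u, w}` only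
if exactly two of the three pairs among `v`, `u`, `w` are edges. Every clustering disagrees with
the graph on some pair of such a bad triple. Therefore, in a round with a uniformly random pivot,
the disagreements made are in expectation at most three times the disagreements of an optimal
clustering on the pairs that the round settles.

When the budget is exhausted, the positive edges left inside `R` become disagreements too. If `x`
is the number of ordered pairs in `R` that are positive edges, then by the Cauchy-Schwarz
inequality a round settles at least `x ^ 2 / |R| ^ 2` of them in expectation. A round makes fewer
than `n` queries, so there are about `Q / n` rounds, and concavity of the solution of the resulting
recurrence shows that at most `n ^ 3 / Q` of these ordered pairs are left in expectation.

The machine keeps the unclustered vertices in a list that it compresses in place, so that a round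
costs `O(|R|)` steps and uses `|R| - 1` of the budget. -/

namespace CorrClust

open scoped Finset

/-! ### Expectations and the main loop -/

section Expectation

variable {α β : Type*}

theorem expect_pure (a : α) (f : α → ℝ≥0∞) : expect (PMF.pure a) f = f a := by
  simp [expect, PMF.pure_apply]

theorem expect_bind (p : PMF α) (g : α → PMF β) (f : β → ℝ≥0∞) :
    expect (p.bind g) f = expect p fun a => expect (g a) f := by
  simp only [expect, PMF.bind_apply, ← ENNReal.tsum_mul_right, ← ENNReal.tsum_mul_left, mul_assoc]
  exact ENNReal.tsum_comm

theorem expect_map (p : PMF α) (g : α → β) (f : β → ℝ≥0∞) :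
    expect (p.map g) f = expect p (f ∘ g) := by
  simp only [PMF.map, expect_bind, Function.comp_def, expect_pure]

theorem expect_uniformOfFinset {s : Finset α} (hs : s.Nonempty) (f : α → ℝ≥0∞) :
    expect (PMF.uniformOfFinset s hs) f = (∑ a ∈ s, f a) / #s := by
  rw [expect, tsum_eq_sum fun a ha => by rw [PMF.uniformOfFinset_apply_of_notMem hs ha, zero_mul],
    ENNReal.div_eq_inv_mul, Finset.mul_sum]
  exact Finset.sum_congr rfl fun a ha => by rw [PMF.uniformOfFinset_apply_of_mem hs ha]

end Expectation

variable {n : ℕ} {G : SimpleGraph (Fin n)} {s : QState n}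

/-- The condition of the main loop. -/
def QState.Continues (s : QState n) : Prop := s.R.Nonempty ∧ #s.R - 1 ≤ s.budget

/-- The state in which the main loop starts. -/
def QState.initial (n Q : ℕ) : QState n where
  R := Finset.univ
  budget := Q
  label := fun _ => 0
  queries := 0

/-- The clustering that is output if the main loop ends in the state `s`. -/
def QState.output (s : QState n) : Fin n → ℕ := fun v => if v ∈ s.R then (v : ℕ) else s.label v

theorem qecc_eq_map (G : SimpleGraph (Fin n)) (Q : ℕ) :
    qecc G Q = (qeccLoop G (QState.initial n Q)).map fun s => (s.output, s.queries) := rfl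

theorem qeccLoop_of_continues (h : s.Continues) :
    qeccLoop G s =
      (PMF.uniformOfFinset s.R.attach (Finset.attach_nonempty_iff.2 h.1)).bind fun v =>
        qeccLoop G (pivotRound G s v) := by
  rw [qeccLoop]
  exact dif_pos h

theorem qeccLoop_of_not_continues (h : ¬ s.Continues) : qeccLoop G s = PMF.pure s := by
  rw [qeccLoop]
  exact dif_neg h

theorem QState.loop_induction (G : SimpleGraph (Fin n)) {motive : QState n → Prop}
    (halt : ∀ s : QState n, ¬ s.Continues → motive s)
    (round : ∀ s : QState n, s.Continues → (∀ v ∈ s.R, motive (pivotRound G s v)) → motive s)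
    (s : QState n) : motive s := by
  induction h : #s.R using Nat.strong_induction_on generalizing s with
  | _ k ih =>
    by_cases hs : s.Continues
    · exact round s hs fun v hv => ih _ (h ▸ pivotRound_card_lt G s hv) _ rfl
    · exact halt s hs

/-- A property of the state that every round of the main loop preserves. -/
def IsLoopInvariant (G : SimpleGraph (Fin n)) (I : QState n → Prop) : Prop :=
  ∀ s, I s → s.Continues → ∀ v ∈ s.R, I (pivotRound G s v)

theorem IsLoopInvariant.of_mem_support {I : QState n → Prop} (hI : IsLoopInvariant G I)
    (hs : I s) : ∀ t ∈ (qeccLoop G s).support, I t := by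
  induction s using QState.loop_induction G with
  | halt s h => simpa [qeccLoop_of_not_continues h] using hs
  | round s h ih =>
    intro t ht
    rw [qeccLoop_of_continues h, PMF.mem_support_bind_iff] at ht
    obtain ⟨v, -, ht⟩ := ht
    exact ih v v.2 (hI s hs h v v.2) t ht

theorem IsLoopInvariant.expect_le_of_potential {I : QState n → Prop} (hI : IsLoopInvariant G I)
    {Ψ f : QState n → ℝ≥0∞}
    (hΨ : ∀ s, I s → s.Continues → ∑ v ∈ s.R, Ψ (pivotRound G s v) ≤ #s.R * Ψ s)
    (hf : ∀ s, I s → ¬ s.Continues → f s ≤ Ψ s) (hs : I s) :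
    expect (qeccLoop G s) f ≤ Ψ s := by
  induction s using QState.loop_induction G with
  | halt s h => simpa only [qeccLoop_of_not_continues h, expect_pure] using hf s hs h
  | round s h ih =>
    rw [qeccLoop_of_continues h, expect_bind, expect_uniformOfFinset, Finset.card_attach]
    refine ENNReal.div_le_of_le_mul' (le_trans ?_ (hΨ s hs h))
    rw [← Finset.sum_attach s.R]
    exact Finset.sum_le_sum fun v _ => ih v v.2 (hI s hs h v v.2)

theorem isLoopInvariant_card_queries_add_budget (G : SimpleGraph (Fin n)) (Q : ℕ) :
    IsLoopInvariant G fun s => Multiset.card s.queries + s.budget = Q := by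
  intro s hs hc v hv
  have := hc.2
  simp only [pivotRound, Multiset.card_add, Multiset.card_map, Finset.card_val,
    Finset.card_erase_of_mem hv]
  omega

theorem card_queries_le (G : SimpleGraph (Fin n)) (Q : ℕ)
    (r : (Fin n → ℕ) × Multiset (Sym2 (Fin n))) (hr : r ∈ (qecc G Q).support) :
    Multiset.card r.2 ≤ Q := by
  rw [qecc_eq_map, PMF.mem_support_map_iff] at hr
  obtain ⟨s, hs, rfl⟩ := hr
  have h := (isLoopInvariant_card_queries_add_budget G Q).of_mem_support
    (by simp [QState.initial]) s hs
  exact le_of_add_le_left h.le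

/-! ### Disagreements and bad triples -/

section Graph

variable {V : Type*}

/-- The graph of the pairs on which the clustering `l` disagrees with `G`. -/
def disagreementGraph (G : SimpleGraph V) (l : V → ℕ) : SimpleGraph V where
  Adj u w := u ≠ w ∧ (l u = l w ↔ ¬ G.Adj u w)
  symm := ⟨fun u w h => ⟨h.1.symm, by rw [eq_comm, G.adj_comm]; exact h.2⟩⟩

open Classical in
/-- Twice the number of edges of `H` inside `R`, as a number of ordered pairs. -/
noncomputable def adjIn (H : SimpleGraph V) (R : Finset V) : ℕ :=
  #{p ∈ R ×ˢ R | H.Adj p.1 p.2}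

open Classical in
/-- Twice the number of edges of `H` that are inside `R` but not inside `T`. -/
noncomputable def adjOutside (H : SimpleGraph V) (R T : Finset V) : ℕ :=
  #{p ∈ R ×ˢ R | H.Adj p.1 p.2 ∧ ¬ (p.1 ∈ T ∧ p.2 ∈ T)}

theorem adjIn_le_sq (H : SimpleGraph V) (R : Finset V) : adjIn H R ≤ #R ^ 2 := by
  classical
  rw [adjIn, sq, ← Finset.card_product]
  exact Finset.card_filter_le _ _

theorem adjIn_add_adjOutside (H : SimpleGraph V) {R T : Finset V} (h : T ⊆ R) :
    adjIn H T + adjOutside H R T = adjIn H R := by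
  classical
  rw [adjIn, adjIn, adjOutside,
    ← Finset.card_filter_add_card_filter_not (s := {p ∈ R ×ˢ R | H.Adj p.1 p.2})
      fun p => p.1 ∈ T ∧ p.2 ∈ T, Finset.filter_filter, Finset.filter_filter]
  congr 2
  ext p
  simp only [Finset.mem_filter, Finset.mem_product]
  have := @h p.1
  have := @h p.2
  tauto

theorem adjIn_univ_eq_two_mul [Fintype V] [LinearOrder V] (H : SimpleGraph V)
    [DecidableRel H.Adj] :
    adjIn H Finset.univ = 2 * #{p : V × V | p.1 < p.2 ∧ H.Adj p.1 p.2} := by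
  have swap : #{p : V × V | H.Adj p.1 p.2 ∧ ¬ p.1 < p.2} =
      #{p : V × V | p.1 < p.2 ∧ H.Adj p.1 p.2} := by
    refine Finset.card_bij' (fun p _ => p.swap) (fun p _ => p.swap) ?_ ?_
      (fun _ _ => rfl) (fun _ _ => rfl)
    · simp only [Finset.mem_filter_univ, Prod.fst_swap, Prod.snd_swap, and_imp, not_lt]
      exact fun p h h' => ⟨h'.lt_of_ne h.ne', h.symm⟩
    · simp only [Finset.mem_filter_univ, Prod.fst_swap, Prod.snd_swap, and_imp, not_lt]
      exact fun p h h' => ⟨h'.symm, h.le⟩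
  calc adjIn H Finset.univ
      = #{p : V × V | H.Adj p.1 p.2} := by
        rw [adjIn, Finset.univ_product_univ]
        congr!
    _ = #{p : V × V | H.Adj p.1 p.2 ∧ p.1 < p.2} + #{p : V × V | H.Adj p.1 p.2 ∧ ¬ p.1 < p.2} := by
        rw [← Finset.card_filter_add_card_filter_not fun p : V × V => p.1 < p.2,
          Finset.filter_filter, Finset.filter_filter]
    _ = _ := by rw [swap, two_mul]; simp only [and_comm]

/-- The vertices `v`, `u`, `w` are distinct and exactly two of the pairs among them are edges. Every
clustering disagrees with `G` on a pair of a bad triple. -/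
def BadTriple (G : SimpleGraph V) (v u w : V) : Prop :=
  u ≠ w ∧ v ≠ u ∧ v ≠ w ∧
    (G.Adj v u ∧ G.Adj v w ∧ ¬ G.Adj u w ∨ G.Adj v u ∧ ¬ G.Adj v w ∧ G.Adj u w ∨
      ¬ G.Adj v u ∧ G.Adj v w ∧ G.Adj u w)

theorem BadTriple.rotate {G : SimpleGraph V} {v u w : V} (h : BadTriple G v u w) :
    BadTriple G u w v := by
  obtain ⟨huw, hvu, hvw, h⟩ := h
  refine ⟨hvw.symm, huw, hvu.symm, ?_⟩
  rw [G.adj_comm w v, G.adj_comm u v]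
  tauto

theorem BadTriple.exists_disagreement {G : SimpleGraph V} {v u w : V} (h : BadTriple G v u w)
    (l : V → ℕ) : (disagreementGraph G l).Adj u w ∨ (disagreementGraph G l).Adj w v ∨
      (disagreementGraph G l).Adj v u := by
  obtain ⟨huw, hvu, hvw, h⟩ := h
  simp only [disagreementGraph, G.adj_comm w v, huw, hvu, hvw.symm, ne_eq, not_false_eq_true,
    true_and]
  by_contra! hc
  grind

open Classical in
/-- The number of ordered pairs in `R` that form a bad triple with `v`. -/
noncomputable def badAt (G : SimpleGraph V) (R : Finset V) (v : V) : ℕ :=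
  #{p ∈ R ×ˢ R | BadTriple G v p.1 p.2}

theorem sum_rotate {M : Type*} [AddCommMonoid M] (R : Finset V) (f : V → V → V → M) :
    ∑ v ∈ R, ∑ u ∈ R, ∑ w ∈ R, f u w v = ∑ v ∈ R, ∑ u ∈ R, ∑ w ∈ R, f v u w := by
  rw [Finset.sum_comm]
  exact Finset.sum_congr rfl fun _ _ => Finset.sum_comm

open Classical in
theorem sum_badAt_le (G : SimpleGraph V) (l : V → ℕ) (R : Finset V) :
    ∑ v ∈ R, badAt G R v ≤ 3 * ∑ v ∈ R,
      #{p ∈ R ×ˢ R | BadTriple G v p.1 p.2 ∧ (disagreementGraph G l).Adj p.1 p.2} := by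
  let b (v u w : V) : ℕ := if BadTriple G v u w ∧ (disagreementGraph G l).Adj u w then 1 else 0
  have charge (v u w : V) : (if BadTriple G v u w then 1 else 0) ≤ b v u w + b u w v + b w v u := by
    by_cases h : BadTriple G v u w
    · have := h.exists_disagreement l
      simp only [b, h, h.rotate, h.rotate.rotate, true_and]
      split_ifs <;> simp_all
    · simp [h]
  have sum_b : ∑ v ∈ R, ∑ u ∈ R, ∑ w ∈ R, (b v u w + b u w v + b w v u) =
      3 * ∑ v ∈ R, ∑ u ∈ R, ∑ w ∈ R, b v u w := by
    have h := sum_rotate R b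
    have h' := sum_rotate R fun v u w => b u w v
    simp only [Finset.sum_add_distrib]
    omega
  simp only [badAt, Finset.card_filter, Finset.sum_product]
  exact (Finset.sum_le_sum fun v _ => Finset.sum_le_sum fun u _ => Finset.sum_le_sum fun w _ =>
    charge v u w).trans_eq sum_b

open Classical in
theorem sq_adjIn_le (H : SimpleGraph V) (R : Finset V) :
    adjIn H R ^ 2 ≤ #R * ∑ v ∈ R, #{p ∈ R ×ˢ R | H.Adj v p.1 ∧ H.Adj p.1 p.2} := by
  let d (u : V) : ℕ := #{w ∈ R | H.Adj u w}
  have sum_d : adjIn H R = ∑ u ∈ R, d u := by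
    simp only [adjIn, d, Finset.card_filter, Finset.sum_product]
  have sum_sq_d : ∑ v ∈ R, #{p ∈ R ×ˢ R | H.Adj v p.1 ∧ H.Adj p.1 p.2} = ∑ u ∈ R, d u ^ 2 := by
    simp only [d, Finset.card_filter, Finset.sum_product, ite_and]
    rw [Finset.sum_comm]
    refine Finset.sum_congr rfl fun u _ => ?_
    simp only [sq, Finset.sum_mul, ite_mul, one_mul, zero_mul, H.adj_comm u]
    refine Finset.sum_congr rfl fun v _ => ?_
    split_ifs <;> simp
  rw [sum_d, sum_sq_d]
  exact sq_sum_le_card_mul_sum_sq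

end Graph

open Classical in
theorem two_mul_cost (G : SimpleGraph (Fin n)) (l : Fin n → ℕ) :
    2 * cost G l = adjIn (disagreementGraph G l) Finset.univ := by
  rw [adjIn_univ_eq_two_mul, cost, ← Finset.card_union_of_disjoint]
  · refine congrArg (2 * ·) (congrArg Finset.card (Finset.ext fun p => ?_))
    simp only [Finset.mem_union, Finset.mem_filter, Finset.mem_univ, true_and, ← and_or_left]
    refine and_congr_right fun h => ?_
    have := h.ne
    simp only [disagreementGraph]
    tauto
  · rw [Finset.disjoint_filter]
    exact fun p _ h h' => h'.2.1 h.2.1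

/-! ### One round -/

section PivotCluster

variable {R : Finset (Fin n)} {u v w : Fin n}

theorem mem_pivotCluster : w ∈ pivotCluster G R v ↔ w = v ∨ w ∈ R ∧ G.Adj v w := by
  simp [pivotCluster]

theorem mem_pivotCluster_of_mem (hw : w ∈ R) : w ∈ pivotCluster G R v ↔ w = v ∨ G.Adj v w := by
  simp [mem_pivotCluster, hw]

theorem mem_pivotCluster_self : v ∈ pivotCluster G R v :=
  mem_pivotCluster.2 (Or.inl rfl)

theorem pivotCluster_subset (hv : v ∈ R) : pivotCluster G R v ⊆ R := by
  intro w hw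
  obtain rfl | h := mem_pivotCluster.1 hw
  exacts [hv, h.1]

theorem card_filter_le_adjOutside_pivotCluster (H : SimpleGraph (Fin n))
    {P : Fin n × Fin n → Prop} [DecidablePred P]
    (hP : ∀ p, P p → H.Adj p.1 p.2 ∧ (G.Adj v p.1 ∨ G.Adj v p.2)) :
    #{p ∈ R ×ˢ R | P p} ≤ adjOutside H R (R \ pivotCluster G R v) := by
  refine Finset.card_le_card fun p hp => ?_
  simp only [Finset.mem_filter, Finset.mem_product, Finset.mem_sdiff] at hp ⊢
  obtain ⟨⟨hu, hw⟩, h⟩ := hp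
  rw [mem_pivotCluster_of_mem hu, mem_pivotCluster_of_mem hw]
  have := hP p h
  tauto

theorem sum_adjIn_add_sum_adjOutside_pivotCluster (G H : SimpleGraph (Fin n))
    (R : Finset (Fin n)) :
    ∑ v ∈ R, adjIn H (R \ pivotCluster G R v) +
      ∑ v ∈ R, adjOutside H R (R \ pivotCluster G R v) = #R * adjIn H R := by
  rw [← Finset.sum_add_distrib,
    Finset.sum_congr rfl fun v _ => adjIn_add_adjOutside H Finset.sdiff_subset, Finset.sum_const,
    smul_eq_mul]

theorem sum_badAt_add_sum_adjIn_le (G : SimpleGraph (Fin n)) (l : Fin n → ℕ)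
    (R : Finset (Fin n)) :
    ∑ v ∈ R, badAt G R v +
        3 * ∑ v ∈ R, adjIn (disagreementGraph G l) (R \ pivotCluster G R v) ≤
      3 * (#R * adjIn (disagreementGraph G l) R) := by
  classical
  have settled := (sum_badAt_le G l R).trans <| Nat.mul_le_mul_left 3 <|
    Finset.sum_le_sum fun v _ =>
      card_filter_le_adjOutside_pivotCluster (G := G) (v := v) (disagreementGraph G l)
        fun p h => ⟨h.2, by have := h.1.2.2.2; tauto⟩
  have := sum_adjIn_add_sum_adjOutside_pivotCluster G (disagreementGraph G l) R
  omega

theorem card_mul_sum_adjIn_add_sq_le (G : SimpleGraph (Fin n)) (R : Finset (Fin n)) :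
    #R * ∑ v ∈ R, adjIn G (R \ pivotCluster G R v) + adjIn G R ^ 2 ≤ #R ^ 2 * adjIn G R := by
  classical
  calc #R * ∑ v ∈ R, adjIn G (R \ pivotCluster G R v) + adjIn G R ^ 2
      ≤ #R * ∑ v ∈ R, adjIn G (R \ pivotCluster G R v) +
          #R * ∑ v ∈ R, adjOutside G R (R \ pivotCluster G R v) := by
        gcongr
        refine (sq_adjIn_le G R).trans ?_
        gcongr with v
        exact card_filter_le_adjOutside_pivotCluster G fun p h => ⟨h.2, Or.inl h.1⟩
    _ = #R ^ 2 * adjIn G R := by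
        rw [← mul_add, sum_adjIn_add_sum_adjOutside_pivotCluster, sq, mul_assoc]

end PivotCluster

section Settled

variable {u v w : Fin n}

/-- No clustered vertex has the name of an unclustered vertex as its label. -/
def QState.LabelsSettled (s : QState n) : Prop := ∀ u ∉ s.R, ∀ w ∈ s.R, s.label u ≠ w

theorem isLoopInvariant_labelsSettled (G : SimpleGraph (Fin n)) :
    IsLoopInvariant G QState.LabelsSettled := by
  intro s hs _ v _ u hu w hw
  simp only [pivotRound, Finset.mem_sdiff] at hu hw ⊢
  split_ifs with hC
  · rintro h
    exact hw.2 (Fin.val_injective h ▸ mem_pivotCluster_self)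
  · exact hs u (by tauto) w hw.1

theorem output_pivotRound_of_notMem (hv : v ∈ s.R) (hu : u ∉ s.R) :
    (pivotRound G s v).output u = s.label u := by
  have hC : u ∉ pivotCluster G s.R v := fun h => hu (pivotCluster_subset hv h)
  simp [QState.output, pivotRound, hu, hC]

theorem output_pivotRound_of_mem (hu : u ∈ s.R) :
    (pivotRound G s v).output u = if u ∈ pivotCluster G s.R v then (v : ℕ) else u := by
  by_cases hC : u ∈ pivotCluster G s.R v <;> simp [QState.output, pivotRound, hu, hC]

theorem QState.LabelsSettled.output_ne (hs : s.LabelsSettled) (hu : u ∉ s.R) (hw : w ∈ s.R) :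
    s.output u ≠ s.output w := by
  simpa only [QState.output, hu, hw, if_true, if_false] using hs u hu w hw

theorem QState.LabelsSettled.output_pivotRound_ne (hs : s.LabelsSettled) (hv : v ∈ s.R)
    (hu : u ∉ s.R) (hw : w ∈ s.R) :
    (pivotRound G s v).output u ≠ (pivotRound G s v).output w := by
  rw [output_pivotRound_of_notMem hv hu, output_pivotRound_of_mem hw]
  split_ifs
  exacts [hs u hu v hv, hs u hu w hw]

theorem QState.LabelsSettled.output_pivotRound_eq_iff (hs : s.LabelsSettled) (hv : v ∈ s.R)
    (h : ¬ (u ∈ s.R ∧ w ∈ s.R)) :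
    (pivotRound G s v).output u = (pivotRound G s v).output w ↔ s.output u = s.output w := by
  by_cases hu : u ∈ s.R
  · have hw : w ∉ s.R := fun hw => h ⟨hu, hw⟩
    exact iff_of_false (hs.output_pivotRound_ne hv hw hu).symm (hs.output_ne hw hu).symm
  by_cases hw : w ∈ s.R
  · exact iff_of_false (hs.output_pivotRound_ne hv hu hw) (hs.output_ne hu hw)
  · rw [output_pivotRound_of_notMem hv hu, output_pivotRound_of_notMem hv hw]
    simp only [QState.output, hu, hw, if_false]

theorem output_pivotRound_eq_iff_of_mem (hu : u ∈ s.R) (hw : w ∈ s.R)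
    (h : u ∈ pivotCluster G s.R v ∨ w ∈ pivotCluster G s.R v) :
    (pivotRound G s v).output u = (pivotRound G s v).output w ↔
      u ∈ pivotCluster G s.R v ∧ w ∈ pivotCluster G s.R v := by
  have hv : v ∈ pivotCluster G s.R v := mem_pivotCluster_self
  rw [output_pivotRound_of_mem hu, output_pivotRound_of_mem hw]
  split_ifs <;> simp only [Fin.val_inj] <;> grind

theorem badTriple_of_disagreement_pivotRound (hu : u ∈ s.R) (hw : w ∈ s.R)
    (h : u ∈ pivotCluster G s.R v ∨ w ∈ pivotCluster G s.R v)
    (hd : (disagreementGraph G (pivotRound G s v).output).Adj u w) : BadTriple G v u w := by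
  obtain ⟨hne, hd⟩ := hd
  rw [output_pivotRound_eq_iff_of_mem hu hw h, mem_pivotCluster_of_mem hu,
    mem_pivotCluster_of_mem hw] at hd
  rw [mem_pivotCluster_of_mem hu, mem_pivotCluster_of_mem hw] at h
  rcases eq_or_ne u v with rfl | hu
  · simp [hne.symm] at hd
  rcases eq_or_ne w v with rfl | hw
  · simp [hne, G.adj_comm w] at hd
  refine ⟨hne, hu.symm, hw.symm, ?_⟩
  tauto

/-- Twice the number of disagreements of the final clustering that are already determined in the
state `s`, namely those on pairs that are not both unclustered. -/
noncomputable def QState.settled (G : SimpleGraph (Fin n)) (s : QState n) : ℕ :=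
  adjOutside (disagreementGraph G s.output) Finset.univ s.R

theorem QState.LabelsSettled.settled_pivotRound_le (hs : s.LabelsSettled) (hv : v ∈ s.R) :
    (pivotRound G s v).settled G ≤ s.settled G + badAt G s.R v := by
  classical
  refine (Finset.card_le_card fun p hp => ?_).trans (Finset.card_union_le _ _)
  simp only [Finset.mem_filter, Finset.mem_union, Finset.mem_product, Finset.mem_univ,
    true_and] at hp ⊢
  obtain ⟨hd, hR⟩ := hp
  by_cases h : p.1 ∈ s.R ∧ p.2 ∈ s.R
  · refine Or.inr ⟨h, badTriple_of_disagreement_pivotRound h.1 h.2 ?_ hd⟩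
    simp only [pivotRound, Finset.mem_sdiff] at hR
    tauto
  · exact Or.inl ⟨⟨hd.1, (hs.output_pivotRound_eq_iff hv h).symm.trans hd.2⟩, h⟩

theorem adjIn_disagreementGraph_output (G : SimpleGraph (Fin n)) (s : QState n) :
    adjIn (disagreementGraph G s.output) s.R = adjIn G s.R := by
  classical
  refine congrArg Finset.card (Finset.filter_congr fun p hp => ?_)
  obtain ⟨hu, hw⟩ := Finset.mem_product.1 hp
  simp only [disagreementGraph, QState.output, hu, hw, if_true, Fin.val_inj]
  refine ⟨fun h => ?_, fun h => ⟨h.ne, by simp [h, h.ne]⟩⟩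
  tauto

theorem two_mul_cost_output (G : SimpleGraph (Fin n)) (s : QState n) :
    2 * cost G s.output = s.settled G + adjIn G s.R := by
  rw [two_mul_cost, ← adjIn_add_adjOutside _ s.R.subset_univ, adjIn_disagreementGraph_output,
    add_comm, QState.settled]

end Settled

/-! ### The potential -/

section Decay

variable {N M k : ℝ}

/-- The solution of the recurrence `x ↦ N * x / (N + x)` after `k` steps from `M`. Since
`x - x ^ 2 / N ≤ N * x / (N + x)`, it bounds a quantity that starts at `M` and decreases in each
step from `x` to `x - x ^ 2 / N`; unlike the latter, it is an explicit function of `k`. -/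
noncomputable def decay (N M k : ℝ) : ℝ := N * M / (N + k * M)

theorem decay_zero (hN : 0 < N) : decay N M 0 = M := by
  rw [decay, zero_mul, add_zero, mul_div_cancel_left₀ M hN.ne']

theorem decay_nonneg (hN : 0 ≤ N) (hM : 0 ≤ M) (hk : 0 ≤ k) : 0 ≤ decay N M k := by
  unfold decay
  positivity

theorem decay_anti {k' : ℝ} (hN : 0 < N) (hM : 0 ≤ M) (hk : 0 ≤ k) (h : k ≤ k') :
    decay N M k' ≤ decay N M k := by
  unfold decay
  gcongr

theorem decay_decay_one (hN : 0 < N) (hM : 0 ≤ M) (hk : 0 ≤ k) :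
    decay N (decay N M 1) k = decay N M (k + 1) := by
  unfold decay
  have : 0 < N + M := by positivity
  have : 0 < N + k * M + M := by positivity
  rw [one_mul]
  field_simp
  ring

theorem sub_sq_div_le_decay_one (hN : 0 < N) (hM : 0 ≤ M) : M - M ^ 2 / N ≤ decay N M 1 := by
  rw [decay, one_mul, le_div_iff₀ (by positivity)]
  have expand : (M - M ^ 2 / N) * (N + M) = N * M - M ^ 3 / N := by
    field_simp
    ring
  have : 0 ≤ M ^ 3 / N := by positivity
  linarith

theorem decay_le_tangent {x y : ℝ} (hN : 0 < N) (hk : 0 ≤ k) (hx : 0 ≤ x) (hy : 0 ≤ y) :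
    decay N y k ≤ decay N x k + N ^ 2 / (N + k * x) ^ 2 * (y - x) := by
  have : 0 < N + k * x := by positivity
  have : 0 < N + k * y := by positivity
  have gap : decay N x k + N ^ 2 / (N + k * x) ^ 2 * (y - x) - decay N y k =
      N ^ 2 * k * (y - x) ^ 2 / ((N + k * x) ^ 2 * (N + k * y)) := by
    unfold decay
    field_simp
    ring
  have : 0 ≤ N ^ 2 * k * (y - x) ^ 2 / ((N + k * x) ^ 2 * (N + k * y)) := by positivity
  linarith

/-- Jensen's inequality for the concave function `x ↦ decay N x k`. -/
theorem sum_decay_le {ι : Type*} {s : Finset ι} {y : ι → ℝ} (hN : 0 < N) (hM : 0 ≤ M)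
    (hk : 0 ≤ k) (hy : ∀ i ∈ s, 0 ≤ y i) (hs : ∑ i ∈ s, y i ≤ #s * (M - M ^ 2 / N)) :
    ∑ i ∈ s, decay N (y i) k ≤ #s * decay N M (k + 1) := by
  set x := decay N M 1
  have hx : 0 ≤ x := decay_nonneg hN.le hM zero_le_one
  have below_mean : ∑ i ∈ s, y i - #s * x ≤ 0 :=
    sub_nonpos.2 (hs.trans (by gcongr; exact sub_sq_div_le_decay_one hN hM))
  calc ∑ i ∈ s, decay N (y i) k
      ≤ ∑ i ∈ s, (decay N x k + N ^ 2 / (N + k * x) ^ 2 * (y i - x)) :=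
        Finset.sum_le_sum fun i hi => decay_le_tangent hN hk hx (hy i hi)
    _ = #s * decay N M (k + 1) + N ^ 2 / (N + k * x) ^ 2 * (∑ i ∈ s, y i - #s * x) := by
        rw [Finset.sum_add_distrib, ← Finset.mul_sum, Finset.sum_sub_distrib,
          decay_decay_one hN hM hk]
        simp
    _ ≤ #s * decay N M (k + 1) :=
        add_le_of_nonpos_right (mul_nonpos_of_nonneg_of_nonpos (by positivity) below_mean)

end Decay

/-- A lower bound for the number of rounds that the budget still allows. -/
noncomputable def QState.roundsLeft (s : QState n) : ℝ := max 0 ((s.budget : ℝ) / n - 1)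

theorem QState.roundsLeft_nonneg (s : QState n) : 0 ≤ s.roundsLeft := le_max_left _ _

theorem QState.card_R_le (s : QState n) : #s.R ≤ n := by
  simpa using Finset.card_le_univ s.R

theorem QState.roundsLeft_le (G : SimpleGraph (Fin n)) (hs : s.Continues) (v : Fin n) :
    s.roundsLeft ≤ (pivotRound G s v).roundsLeft + 1 := by
  have hn : (0 : ℝ) < n := by exact_mod_cast v.pos
  have budget_le : (s.budget : ℝ) ≤ (pivotRound G s v).budget + n := by
    have := s.card_R_le
    have := hs.2
    have : s.budget ≤ (pivotRound G s v).budget + n := by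
      simp only [pivotRound]
      omega
    exact_mod_cast this
  have : (s.budget : ℝ) / n ≤ (pivotRound G s v).budget / n + 1 := by
    rw [div_add_one hn.ne']
    gcongr
  refine max_le (add_nonneg (QState.roundsLeft_nonneg _) zero_le_one) ?_
  have : ((pivotRound G s v).budget : ℝ) / n - 1 ≤ (pivotRound G s v).roundsLeft := le_max_right _ _
  linarith

theorem sum_adjIn_pivotRound_le (G : SimpleGraph (Fin n)) (s : QState n) :
    ∑ v ∈ s.R, (adjIn G (pivotRound G s v).R : ℝ) ≤
      #s.R * (adjIn G s.R - (adjIn G s.R : ℝ) ^ 2 / (n : ℝ) ^ 2) := by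
  set M := (adjIn G s.R : ℝ) with hM
  obtain hR | hR := s.R.eq_empty_or_nonempty
  · simp [hR]
  have hr : (0 : ℝ) < #s.R := by exact_mod_cast hR.card_pos
  have hrn : (#s.R : ℝ) ≤ n := by exact_mod_cast s.card_R_le
  have total : #s.R * ∑ v ∈ s.R, (adjIn G (pivotRound G s v).R : ℝ) + M ^ 2 ≤ #s.R ^ 2 * M := by
    rw [hM]
    exact_mod_cast card_mul_sum_adjIn_add_sq_le G s.R
  refine le_of_mul_le_mul_left ?_ hr
  calc #s.R * ∑ v ∈ s.R, (adjIn G (pivotRound G s v).R : ℝ)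
      ≤ #s.R ^ 2 * (M - M ^ 2 / #s.R ^ 2) := by
        rw [mul_sub, mul_div_cancel₀ _ (by positivity)]
        linarith
    _ ≤ #s.R ^ 2 * (M - M ^ 2 / n ^ 2) := by gcongr
    _ = _ := by ring

theorem sum_decay_pivotRound_le (G : SimpleGraph (Fin n)) (hs : s.Continues) :
    ∑ v ∈ s.R, decay ((n : ℝ) ^ 2) (adjIn G (pivotRound G s v).R) (pivotRound G s v).roundsLeft ≤
      #s.R * decay ((n : ℝ) ^ 2) (adjIn G s.R) s.roundsLeft := by
  obtain ⟨v₀, -⟩ := hs.1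
  have hn : (0 : ℝ) < n := by exact_mod_cast v₀.pos
  have roundsLeft_eq (v : Fin n) : (pivotRound G s v).roundsLeft = (pivotRound G s v₀).roundsLeft :=
    rfl
  simp only [roundsLeft_eq]
  calc _ ≤ #s.R * decay ((n : ℝ) ^ 2) (adjIn G s.R) ((pivotRound G s v₀).roundsLeft + 1) :=
        sum_decay_le (by positivity) (Nat.cast_nonneg _) (QState.roundsLeft_nonneg _)
          (fun _ _ => Nat.cast_nonneg _) (sum_adjIn_pivotRound_le G s)
    _ ≤ _ := by
        gcongr
        exact decay_anti (by positivity) (Nat.cast_nonneg _) s.roundsLeft_nonneg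
          (QState.roundsLeft_le G hs v₀)

/-- Half the sum of the disagreements settled so far, three times the disagreements of the
reference clustering `l` that are left, and a bound for the positive edges that are expected to be
left when the budget is exhausted; all three count ordered pairs. -/
noncomputable def potential (G : SimpleGraph (Fin n)) (l : Fin n → ℕ) (s : QState n) : ℝ :=
  (s.settled G + 3 * adjIn (disagreementGraph G l) s.R +
    decay ((n : ℝ) ^ 2) (adjIn G s.R) s.roundsLeft) / 2

theorem potential_nonneg (G : SimpleGraph (Fin n)) (l : Fin n → ℕ) (s : QState n) :
    0 ≤ potential G l s := by
  have := decay_nonneg (sq_nonneg (n : ℝ)) (Nat.cast_nonneg (adjIn G s.R)) s.roundsLeft_nonneg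
  unfold potential
  positivity

theorem QState.LabelsSettled.sum_potential_le (hs : s.LabelsSettled) (hc : s.Continues)
    (l : Fin n → ℕ) :
    ∑ v ∈ s.R, potential G l (pivotRound G s v) ≤ #s.R * potential G l s := by
  have settled_le : ∑ v ∈ s.R, ((pivotRound G s v).settled G : ℝ) ≤
      #s.R * s.settled G + ∑ v ∈ s.R, (badAt G s.R v : ℝ) := by
    have := Finset.sum_le_sum fun v (hv : v ∈ s.R) => hs.settled_pivotRound_le (G := G) hv
    rw [Finset.sum_add_distrib, Finset.sum_const, smul_eq_mul] at this
    exact_mod_cast this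
  have bad_le : ∑ v ∈ s.R, (badAt G s.R v : ℝ) +
      3 * ∑ v ∈ s.R, (adjIn (disagreementGraph G l) (pivotRound G s v).R : ℝ) ≤
        3 * (#s.R * adjIn (disagreementGraph G l) s.R) := by
    exact_mod_cast sum_badAt_add_sum_adjIn_le G l s.R
  have decay_le := sum_decay_pivotRound_le G hc
  simp only [potential]
  rw [← Finset.sum_div, Finset.sum_add_distrib, Finset.sum_add_distrib, ← Finset.mul_sum]
  linarith

theorem adjIn_le_decay_of_not_continues (hs : ¬ s.Continues) :
    (adjIn G s.R : ℝ) ≤ decay ((n : ℝ) ^ 2) (adjIn G s.R) s.roundsLeft := by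
  obtain hR | hR := s.R.eq_empty_or_nonempty
  · have : adjIn G s.R = 0 := Nat.le_zero.1 ((adjIn_le_sq G s.R).trans_eq (by simp [hR]))
    rw [this, Nat.cast_zero]
    exact decay_nonneg (sq_nonneg _) le_rfl s.roundsLeft_nonneg
  · have hn : (0 : ℝ) < n := by exact_mod_cast hR.choose.pos
    have budget_le : (s.budget : ℝ) ≤ n := by
      have := s.card_R_le
      have : ¬ #s.R - 1 ≤ s.budget := fun h => hs ⟨hR, h⟩
      exact_mod_cast (by omega : s.budget ≤ n)
    have : s.roundsLeft = 0 := max_eq_left (by rwa [sub_nonpos, div_le_one hn])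
    rw [this, decay_zero (by positivity)]

theorem cost_output_le_potential (l : Fin n → ℕ) (hs : ¬ s.Continues) :
    (cost G s.output : ℝ) ≤ potential G l s := by
  have cost_eq : (2 : ℝ) * cost G s.output = s.settled G + adjIn G s.R := by
    exact_mod_cast two_mul_cost_output G s
  have left_le := adjIn_le_decay_of_not_continues (G := G) hs
  have : (0 : ℝ) ≤ adjIn (disagreementGraph G l) s.R := Nat.cast_nonneg _
  unfold potential
  linarith

theorem decay_roundsLeft_le (G : SimpleGraph (Fin n)) (hs : 0 < s.budget) :
    decay ((n : ℝ) ^ 2) (adjIn G s.R) s.roundsLeft ≤ (n : ℝ) ^ 3 / s.budget := by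
  obtain rfl | hn := n.eq_zero_or_pos
  · simp [decay]
  have hn' : (0 : ℝ) < n := by exact_mod_cast hn
  have hs' : (0 : ℝ) < s.budget := by exact_mod_cast hs
  have hk := QState.roundsLeft_nonneg s
  set M := (adjIn G s.R : ℝ) with hM
  have M_le : M ≤ (n : ℝ) ^ 2 := by
    rw [hM]
    exact_mod_cast (adjIn_le_sq G s.R).trans (Nat.pow_le_pow_left s.card_R_le 2)
  have budget_le : (s.budget : ℝ) ≤ n * (s.roundsLeft + 1) := by
    rw [mul_comm, ← div_le_iff₀ hn', ← sub_le_iff_le_add]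
    exact le_max_right _ _
  unfold decay
  rw [div_le_div_iff₀ (by positivity) hs']
  calc (n : ℝ) ^ 2 * M * s.budget
      ≤ (n : ℝ) ^ 2 * M * (n * (s.roundsLeft + 1)) := by gcongr
    _ = (n : ℝ) ^ 3 * (M + s.roundsLeft * M) := by ring
    _ ≤ (n : ℝ) ^ 3 * ((n : ℝ) ^ 2 + s.roundsLeft * M) := by gcongr

theorem potential_initial_le (G : SimpleGraph (Fin n)) (l : Fin n → ℕ) {Q : ℕ} (hQ : 0 < Q) :
    potential G l (QState.initial n Q) ≤ 3 * cost G l + (n : ℝ) ^ 3 / (2 * Q) := by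
  have settled_eq : (QState.initial n Q).settled G = 0 := by
    simp [QState.settled, QState.initial, adjOutside]
  have left_eq : (adjIn (disagreementGraph G l) (QState.initial n Q).R : ℝ) = 2 * cost G l := by
    exact_mod_cast (two_mul_cost G l).symm
  have decay_le := decay_roundsLeft_le (s := QState.initial n Q) G hQ
  calc potential G l (QState.initial n Q)
      ≤ (0 + 3 * (2 * cost G l) + (n : ℝ) ^ 3 / Q) / 2 := by
        rw [potential, settled_eq, left_eq, Nat.cast_zero]
        gcongr
        exact decay_le
    _ = 3 * cost G l + (n : ℝ) ^ 3 / (2 * Q) := by ring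

theorem exists_cost_eq_opt (G : SimpleGraph (Fin n)) : ∃ l, cost G l = opt G :=
  Nat.sInf_mem (Set.range_nonempty fun l : Fin n → ℕ => cost G l)

theorem expect_cost_qecc_le (G : SimpleGraph (Fin n)) {Q : ℕ} (hQ : 0 < Q) :
    expect (qecc G Q) (fun r => (cost G r.1 : ℝ≥0∞)) ≤
      3 * (opt G : ℝ≥0∞) + (n : ℝ≥0∞) ^ 3 / (2 * (Q : ℝ≥0∞)) := by
  obtain ⟨l, hl⟩ := exists_cost_eq_opt G
  have : (0 : ℝ) < Q := by exact_mod_cast hQ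
  rw [qecc_eq_map, expect_map]
  calc expect (qeccLoop G (QState.initial n Q)) (fun s => (cost G s.output : ℝ≥0∞))
      ≤ ENNReal.ofReal (potential G l (QState.initial n Q)) := by
        refine (isLoopInvariant_labelsSettled G).expect_le_of_potential
          (Ψ := fun s => ENNReal.ofReal (potential G l s)) (fun s hs hc => ?_)
          (fun s _ hc => ?_) fun u hu => absurd (Finset.mem_univ u) hu
        · rw [← ENNReal.ofReal_sum_of_nonneg fun v _ => potential_nonneg G l _,
            ← ENNReal.ofReal_natCast, ← ENNReal.ofReal_mul (Nat.cast_nonneg _)]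
          exact ENNReal.ofReal_le_ofReal (hs.sum_potential_le hc l)
        · rw [← ENNReal.ofReal_natCast]
          exact ENNReal.ofReal_le_ofReal (cost_output_le_potential l hc)
    _ ≤ ENNReal.ofReal (3 * cost G l + (n : ℝ) ^ 3 / (2 * Q)) :=
        ENNReal.ofReal_le_ofReal (potential_initial_le G l hQ)
    _ = 3 * (opt G : ℝ≥0∞) + (n : ℝ≥0∞) ^ 3 / (2 * (Q : ℝ≥0∞)) := by
        rw [← hl, ENNReal.ofReal_add (by positivity) (by positivity),
          ENNReal.ofReal_div_of_pos (by positivity), ENNReal.ofReal_mul (by positivity),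
          ENNReal.ofReal_mul (by positivity), ENNReal.ofReal_pow (by positivity)]
        simp only [ENNReal.ofReal_natCast, ENNReal.ofReal_ofNat]

/-! ### Runs of the machine -/

section Machine

variable {P : List Instr} {O : ℕ → ℕ → ℕ} {α β : Type*} {f : Config → β} {a b T : ℕ}
  {c c₁ c₂ c₃ : Config} {μ : PMF β}

theorem run_succ (P : List Instr) (O : ℕ → ℕ → ℕ) (t : ℕ) (c : Config) :
    run P O (t + 1) c = (step P O c).bind (run P O t) := rfl

theorem run_add (P : List Instr) (O : ℕ → ℕ → ℕ) (a b : ℕ) (c : Config) :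
    run P O (a + b) c = (run P O a c).bind (run P O b) := by
  induction a generalizing c with
  | zero => simp [run]
  | succ a ih =>
    rw [Nat.add_right_comm, run_succ, run_succ, PMF.bind_bind]
    exact congrArg _ (funext ih)

theorem run_of_halted (O : ℕ → ℕ → ℕ) (t : ℕ) (h : Halted P c) : run P O t c = PMF.pure c := by
  induction t with
  | zero => rfl
  | succ t ih => rw [run_succ, step, List.getElem?_eq_none h, PMF.pure_bind, ih]

theorem bind_congr_of_mem_support {p : PMF α} {g h : α → PMF β}
    (H : ∀ a ∈ p.support, g a = h a) : p.bind g = p.bind h := by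
  ext b
  rw [PMF.bind_apply, PMF.bind_apply]
  refine tsum_congr fun a => ?_
  by_cases ha : p a = 0
  · rw [ha, zero_mul, zero_mul]
  · rw [H a ((p.mem_support_iff a).2 ha)]

/-- From `c`, the program reaches `c'` within `b` steps, whatever the random choices. -/
def Reaches (P : List Instr) (O : ℕ → ℕ → ℕ) (b : ℕ) (c c' : Config) : Prop :=
  ∃ k ≤ b, run P O k c = PMF.pure c'

theorem Reaches.refl (P : List Instr) (O : ℕ → ℕ → ℕ) (c : Config) : Reaches P O 0 c c :=
  ⟨0, le_rfl, rfl⟩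

theorem Reaches.trans (h : Reaches P O a c₁ c₂) (h' : Reaches P O b c₂ c₃) :
    Reaches P O (a + b) c₁ c₃ := by
  obtain ⟨k, hk, e⟩ := h
  obtain ⟨k', hk', e'⟩ := h'
  exact ⟨k + k', add_le_add hk hk', by rw [run_add, e, PMF.pure_bind, e']⟩

/-- Started in `c`, the program always halts within `T` steps, and then the value of `f` has the
distribution `μ`. -/
def Outputs (P : List Instr) (O : ℕ → ℕ → ℕ) (f : Config → β) (T : ℕ) (c : Config) (μ : PMF β) :
    Prop :=
  (∀ c' ∈ (run P O T c).support, Halted P c') ∧ (run P O T c).map f = μ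

theorem Outputs.of_halted (h : Halted P c) : Outputs P O f T c (PMF.pure (f c)) := by
  rw [Outputs, run_of_halted O T h, PMF.pure_map]
  simp [h]

theorem Outputs.mono (h : Outputs P O f a c μ) (hab : a ≤ b) : Outputs P O f b c μ := by
  obtain ⟨k, rfl⟩ := Nat.exists_eq_add_of_le hab
  have run_eq : run P O (a + k) c = run P O a c := by
    rw [run_add, bind_congr_of_mem_support fun c' hc' => run_of_halted O k (h.1 c' hc'),
      PMF.bind_pure]
  rwa [Outputs, run_eq]

theorem Outputs.of_run_eq_map {p : PMF α} {F : α → Config} {ν : α → PMF β}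
    (hp : run P O a c = p.map F) (h : ∀ i ∈ p.support, Outputs P O f T (F i) (ν i)) :
    Outputs P O f (a + T) c (p.bind ν) := by
  have run_eq : run P O (a + T) c = p.bind fun i => run P O T (F i) := by
    rw [run_add, hp, PMF.bind_map]
    rfl
  refine ⟨fun c' hc' => ?_, ?_⟩
  · rw [run_eq, PMF.mem_support_bind_iff] at hc'
    obtain ⟨i, hi, hc'⟩ := hc'
    exact (h i hi).1 c' hc'
  · rw [run_eq, PMF.map_bind]
    exact bind_congr_of_mem_support fun i hi => (h i hi).2

theorem Outputs.of_reaches (h : Reaches P O a c₁ c₂) (h' : Outputs P O f T c₂ μ) :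
    Outputs P O f (a + T) c₁ μ := by
  obtain ⟨k, hk, e⟩ := h
  have : Outputs P O f (k + T) c₁ ((PMF.pure ()).bind fun _ => μ) :=
    .of_run_eq_map (F := fun _ => c₂) (by rw [e, PMF.pure_map]) fun _ _ => h'
  rw [PMF.pure_bind] at this
  exact this.mono (by omega)

end Machine

theorem edgeOracle_pos_iff (u v : Fin n) : 0 < edgeOracle G u v ↔ G.Adj u v := by
  by_cases h : G.Adj u v <;> simp [edgeOracle, h]

theorem uniformBelow_length {α : Type*} [DecidableEq α] {L : List α} (hL : L.Nodup) {R : Finset α}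
    (hLR : L.toFinset = R) (hR : R.attach.Nonempty) :
    uniformBelow L.length = (PMF.uniformOfFinset R.attach hR).map fun v => L.idxOf v.1 := by
  subst hLR
  have hpos : L.length ≠ 0 := by
    obtain ⟨⟨u, hu⟩, -⟩ := hR
    exact (List.length_pos_of_mem (List.mem_toFinset.1 hu)).ne'
  ext j
  rw [uniformBelow, dif_neg hpos, PMF.map_apply, tsum_fintype]
  simp only [PMF.uniformOfFinset_apply, Finset.mem_attach, if_true, Finset.card_attach,
    List.toFinset_card_of_nodup hL, Finset.card_range, Finset.mem_range]
  split_ifs with hj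
  · rw [Finset.sum_eq_single ⟨L[j], by simp⟩, if_pos (hL.idxOf_getElem j hj).symm]
    · rintro ⟨u, hu⟩ - hne
      refine if_neg fun h => hne (Subtype.ext ?_)
      simp [h]
    · simp
  · refine (Finset.sum_eq_zero ?_).symm
    rintro ⟨u, hu⟩ -
    have := List.idxOf_lt_length_of_mem (List.mem_toFinset.1 hu)
    exact if_neg (ne_of_gt (this.trans_le (not_lt.1 hj)))

/-! ### A program for QECC -/

/-- The names of the registers that the program uses, in the order of their numbers; the machine
starts with the input in the registers `n` and `budget`. -/
inductive Reg
  /-- the number of vertices -/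
  | n
  /-- the remaining query budget -/
  | budget
  /-- the number of unclustered vertices -/
  | size
  /-- the constant one -/
  | one
  /-- the constant zero -/
  | zero
  /-- the number of list entries compared with the pivot -/
  | next
  /-- a memory address -/
  | addr
  /-- the pivot -/
  | pivot
  /-- what is written into the cells of the cluster of the pivot -/
  | label
  /-- the number of list entries kept -/
  | kept
  /-- the vertex compared with the pivot -/
  | vertex
  /-- intermediate results -/
  | scratch

instance : Coe Reg ℕ := ⟨Reg.ctorIdx⟩

/-- The jump targets of the program. -/
inductive Target
  | list
  | listVertex
  | loop
  | round
  | scan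
  | compare
  | join
  | ask
  | exit

/-- The position of a jump target in the program. -/
def Target.pos : Target → ℕ
  | .list => 4
  | .listVertex => 6
  | .loop => 10
  | .round => 12
  | .scan => 21
  | .compare => 24
  | .join => 29
  | .ask => 31
  | .exit => 37

instance : Coe Target ℕ := ⟨Target.pos⟩

open Reg Target in
/-- A program for QECC. It holds the list of the unclustered vertices in the memory cells from `n`
on, and compresses it in place in each round. If `Q + 1 < n`, then QECC makes no query, and the
program exits before it spends time on writing the list. -/
def qeccProgram : List Instr :=
  [.const one 1,
    .add size budget one,
    .jumpLt size Reg.n exit,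
    .const size 0,
    -- list
    .jumpLt size Reg.n listVertex,
    .jump loop,
    -- listVertex
    .add addr Reg.n size,
    .store addr size,
    .add size size one,
    .jump list,
    -- loop
    .jumpLt zero size round,
    .jump exit,
    -- round
    .sub scratch size one,
    .jumpLt budget scratch exit,
    .sub budget budget scratch,
    .rand addr size,
    .add addr Reg.n addr,
    .load pivot addr,
    .add label pivot one,
    .const next 0,
    .const kept 0,
    -- scan
    .jumpLt next size compare,
    .move size kept,
    .jump loop,
    -- compare
    .add addr Reg.n next,
    .load vertex addr,
    .add next next one,
    .jumpLt vertex pivot ask,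
    .jumpLt pivot vertex ask,
    -- join
    .store vertex label,
    .jump scan,
    -- ask
    .query scratch pivot vertex,
    .jumpLt zero scratch join,
    .add addr Reg.n kept,
    .store addr vertex,
    .add kept kept one,
    .jump scan]

/-- The contents of the registers at `list` and at `loop`, with the number of vertices `n`, the
budget `b` and a list of length `r`. -/
structure LoopRegs (n b r : ℕ) (reg : ℕ → ℕ) : Prop where
  n : reg Reg.n = n
  budget : reg Reg.budget = b
  size : reg Reg.size = r
  one : reg Reg.one = 1
  zero : reg Reg.zero = 0

/-- The contents of the registers at `scan`: in addition, the pivot is `v`, and `i` list entries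
have been compared with it, of which `k` were kept. -/
structure ScanRegs (n b r v i k : ℕ) (reg : ℕ → ℕ) : Prop extends LoopRegs n b r reg where
  pivot : reg Reg.pivot = v
  label : reg Reg.label = v + 1
  next : reg Reg.next = i
  kept : reg Reg.kept = k

/-- The vertex `w` is put into the cluster of the pivot `v`. -/
def Joins (O : ℕ → ℕ → ℕ) (v w : ℕ) : Prop := w = v ∨ 0 < O v w

instance (O : ℕ → ℕ → ℕ) (v : ℕ) : DecidablePred (Joins O v) :=
  fun _ => inferInstanceAs (Decidable (_ ∨ _))

/-- The queries made when the vertices of `L` are compared with `v`. -/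
def scanQueries (v : ℕ) (L : List ℕ) : Multiset (Sym2 ℕ) :=
  ((L.filter fun w => w ≠ v).map fun w => s(v, w) : List (Sym2 ℕ))

section Blocks

attribute [local simp] run step qeccProgram Instr.exec Config.set Target.pos Reg.ctorIdx

variable {O : ℕ → ℕ → ℕ} {reg mem : ℕ → ℕ} {q : Multiset (Sym2 ℕ)} {b r v w i k : ℕ}

theorem reaches_exit_of_lt (h : reg Reg.budget + 1 < reg Reg.n) :
    ∃ reg', Reaches qeccProgram O 3 ⟨0, reg, mem, q⟩ ⟨Target.exit, reg', mem, q⟩ := by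
  simp only [Reg.ctorIdx] at h
  exact ⟨_, 3, le_rfl, by simp [h]; rfl⟩

theorem reaches_list (h : reg Reg.n ≤ reg Reg.budget + 1) (h0 : reg Reg.zero = 0) :
    ∃ reg', Reaches qeccProgram O 4 ⟨0, reg, mem, q⟩ ⟨Target.list, reg', mem, q⟩ ∧
      LoopRegs (reg Reg.n) (reg Reg.budget) 0 reg' := by
  simp only [Reg.ctorIdx] at h h0
  exact ⟨_, ⟨4, le_rfl, by simp [h.not_gt]; rfl⟩, by constructor <;> simp [h0]⟩

theorem LoopRegs.reaches_listVertex (h : LoopRegs n b i reg) (hi : i < n) :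
    ∃ reg', Reaches qeccProgram O 5 ⟨Target.list, reg, mem, q⟩
        ⟨Target.list, reg', Function.update mem (n + i) i, q⟩ ∧ LoopRegs n b (i + 1) reg' := by
  obtain ⟨hn, hb, hr, h1, h0⟩ := h
  simp only [Reg.ctorIdx] at hn hb hr h1 h0
  exact ⟨_, ⟨5, le_rfl, by simp [*]; rfl⟩, by constructor <;> simp [*]⟩

theorem LoopRegs.reaches_loop (h : LoopRegs n b n reg) :
    Reaches qeccProgram O 2 ⟨Target.list, reg, mem, q⟩ ⟨Target.loop, reg, mem, q⟩ := by
  obtain ⟨hn, -, hr, -, -⟩ := h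
  simp only [Reg.ctorIdx] at hn hr
  exact ⟨2, le_rfl, by simp [*]⟩

theorem LoopRegs.reaches_exit (h : LoopRegs n b r reg) (hr : r = 0 ∨ b < r - 1) :
    ∃ reg', Reaches qeccProgram O 3 ⟨Target.loop, reg, mem, q⟩ ⟨Target.exit, reg', mem, q⟩ := by
  obtain ⟨-, hb, hr', h1, h0⟩ := h
  simp only [Reg.ctorIdx] at hb hr' h1 h0
  obtain rfl | hlt := hr
  · exact ⟨_, 2, by norm_num, by simp [*]; rfl⟩
  · have : 0 < r := by omega
    exact ⟨_, 3, le_rfl, by simp [*]; rfl⟩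

theorem LoopRegs.run_round (h : LoopRegs n b r reg) (hr : 0 < r) (hb : r - 1 ≤ b) :
    ∃ F : ℕ → ℕ → ℕ, run qeccProgram O 10 ⟨Target.loop, reg, mem, q⟩ =
        (uniformBelow r).map (fun j => ⟨Target.scan, F j, mem, q⟩) ∧
      ∀ j, ScanRegs n (b - (r - 1)) r (mem (n + j)) 0 0 (F j) := by
  obtain ⟨hn, hb', hr', h1, h0⟩ := h
  simp only [Reg.ctorIdx] at hn hb' hr' h1 h0
  exact ⟨_, by simp [hb.not_gt, PMF.bind_map, Function.comp_def, *]; rfl,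
    fun j => by constructor; constructor; all_goals simp [*]⟩

theorem ScanRegs.reaches_loop (h : ScanRegs n b r v r k reg) :
    ∃ reg', Reaches qeccProgram O 3 ⟨Target.scan, reg, mem, q⟩ ⟨Target.loop, reg', mem, q⟩ ∧
      LoopRegs n b k reg' := by
  obtain ⟨⟨hn, hb, hr, h1, h0⟩, -, -, hi, hk⟩ := h
  simp only [Reg.ctorIdx] at hn hb hr h1 h0 hi hk
  exact ⟨_, ⟨3, le_rfl, by simp [*]; rfl⟩, by constructor <;> simp [*]⟩

theorem ScanRegs.reaches_join (h : ScanRegs n b r v i k reg) (hi : i < r)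
    (hw : mem (n + i) = w) (hj : Joins O v w) :
    ∃ reg', Reaches qeccProgram O 12 ⟨Target.scan, reg, mem, q⟩
        ⟨Target.scan, reg', Function.update mem w (v + 1), scanQueries v [w] + q⟩ ∧
      ScanRegs n b r v (i + 1) k reg' := by
  obtain ⟨⟨hn, hb, hr, h1, h0⟩, hv, hl, hi', hk⟩ := h
  simp only [Reg.ctorIdx] at hn hb hr h1 h0 hv hl hi' hk
  obtain rfl | hne := eq_or_ne w v
  · exact ⟨_, ⟨8, by norm_num, by simp [*, scanQueries]; rfl⟩,
      by constructor; constructor; all_goals simp [*]⟩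
  · have hO : 0 < O v w := hj.resolve_left hne
    obtain hlt | hgt := hne.lt_or_gt
    · exact ⟨_, ⟨9, by norm_num, by simp [*, scanQueries]; rfl⟩,
        by constructor; constructor; all_goals simp [*]⟩
    · exact ⟨_, ⟨10, by norm_num, by simp [*, scanQueries, hgt.not_gt]; rfl⟩,
        by constructor; constructor; all_goals simp [*]⟩

theorem ScanRegs.reaches_keep (h : ScanRegs n b r v i k reg) (hi : i < r)
    (hw : mem (n + i) = w) (hj : ¬ Joins O v w) :
    ∃ reg', Reaches qeccProgram O 12 ⟨Target.scan, reg, mem, q⟩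
        ⟨Target.scan, reg', Function.update mem (n + k) w, scanQueries v [w] + q⟩ ∧
      ScanRegs n b r v (i + 1) (k + 1) reg' := by
  obtain ⟨⟨hn, hb, hr, h1, h0⟩, hv, hl, hi', hk⟩ := h
  simp only [Reg.ctorIdx] at hn hb hr h1 h0 hv hl hi' hk
  obtain ⟨hne, hO⟩ : w ≠ v ∧ O v w = 0 := by simpa [Joins] using hj
  obtain hlt | hgt := hne.lt_or_gt
  · exact ⟨_, ⟨11, by norm_num, by simp [*, scanQueries]; rfl⟩,
      by constructor; constructor; all_goals simp [*]⟩
  · exact ⟨_, ⟨12, by norm_num, by simp [*, scanQueries, hgt.not_gt]; rfl⟩,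
      by constructor; constructor; all_goals simp [*]⟩

end Blocks

/-- The list `L` is held in the memory cells from `a` on. -/
def ListAt (mem : ℕ → ℕ) (a : ℕ) (L : List ℕ) : Prop :=
  ∀ (j : ℕ) (hj : j < L.length), mem (a + j) = L[j]

section ListAt

variable {mem : ℕ → ℕ} {a b x : ℕ} {L : List ℕ}

theorem listAt_nil : ListAt mem a [] := fun _ hj => absurd hj (Nat.not_lt_zero _)

theorem listAt_cons : ListAt mem a (x :: L) ↔ mem a = x ∧ ListAt mem (a + 1) L := by
  refine ⟨fun h => ⟨h 0 (Nat.zero_lt_succ _), fun j hj => ?_⟩, fun h j hj => ?_⟩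
  · rw [Nat.add_assoc, Nat.add_comm 1]
    exact h (j + 1) (Nat.succ_lt_succ hj)
  · cases j with
    | zero => exact h.1
    | succ j =>
      rw [← Nat.add_assoc, Nat.add_right_comm]
      exact h.2 j (Nat.lt_of_succ_lt_succ hj)

theorem ListAt.update_of_lt (h : ListAt mem a L) (hb : b < a) :
    ListAt (Function.update mem b x) a L := fun j hj => by
  rw [Function.update_of_ne (by omega), h j hj]

theorem ListAt.update_append (h : ListAt mem a L) :
    ListAt (Function.update mem (a + L.length) x) a (L ++ [x]) := by
  intro j hj
  obtain hlt | rfl := (Nat.lt_succ_iff.1 (List.length_append.symm ▸ hj)).lt_or_eq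
  · rw [Function.update_of_ne (by omega), h j hlt, List.getElem_append_left hlt]
  · simp

end ListAt

theorem scanQueries_cons (v w : ℕ) (L : List ℕ) :
    scanQueries v (w :: L) = scanQueries v L + scanQueries v [w] := by
  rw [add_comm]
  simp only [scanQueries, Multiset.coe_add, ← List.map_append, ← List.filter_append,
    List.singleton_append]

theorem ScanRegs.reaches_scan_end {O : ℕ → ℕ → ℕ} {reg mem : ℕ → ℕ} {q : Multiset (Sym2 ℕ)}
    {b r v i : ℕ} {kept rest : List ℕ} (h : ScanRegs n b r v i kept.length reg)
    (hrest : ListAt mem (n + i) rest) (hkept : ListAt mem n kept) (hi : i + rest.length = r)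
    (hk : kept.length ≤ i) (hlt : ∀ w ∈ rest, w < n) :
    ∃ reg' mem', Reaches qeccProgram O (12 * rest.length) ⟨Target.scan, reg, mem, q⟩
        ⟨Target.scan, reg', mem', scanQueries v rest + q⟩ ∧
      ScanRegs n b r v r (kept ++ rest.filter (¬ Joins O v ·)).length reg' ∧
      ListAt mem' n (kept ++ rest.filter (¬ Joins O v ·)) ∧
      ∀ u < n, mem' u = if u ∈ rest ∧ Joins O v u then v + 1 else mem u := by
  induction rest generalizing reg mem q i kept with
  | nil =>
    obtain rfl : i = r := hi
    exact ⟨reg, mem, by simpa [scanQueries] using Reaches.refl _ _ _, by simpa using h,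
      by simpa using hkept, by simp⟩
  | cons w rest ih =>
    obtain ⟨hw, hrest⟩ := listAt_cons.1 hrest
    rw [List.length_cons] at hi
    have hwn : w < n := hlt w List.mem_cons_self
    replace hlt : ∀ w ∈ rest, w < n := fun u hu => hlt u (List.mem_cons_of_mem _ hu)
    rw [scanQueries_cons, add_assoc, List.length_cons, Nat.mul_succ, Nat.add_comm (12 * _)]
    by_cases hj : Joins O v w
    · obtain ⟨reg₁, reach₁, h₁⟩ := h.reaches_join (O := O) (q := q) (by omega) hw hj
      obtain ⟨reg₂, mem₂, reach₂, h₂, hL, hlabel⟩ := ih (i := i + 1) h₁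
        (hrest.update_of_lt (by omega)) (hkept.update_of_lt hwn) (by omega) (by omega) hlt
      refine ⟨reg₂, mem₂, reach₁.trans reach₂, by simpa [hj] using h₂, by simpa [hj] using hL,
        fun u hu => ?_⟩
      rw [hlabel u hu]
      by_cases huw : u = w <;> simp [huw, hj]
    · obtain ⟨reg₁, reach₁, h₁⟩ := h.reaches_keep (O := O) (q := q) (by omega) hw hj
      obtain ⟨reg₂, mem₂, reach₂, h₂, hL, hlabel⟩ := ih (i := i + 1) (kept := kept ++ [w])
        (by simpa using h₁)
        (hrest.update_of_lt (by omega)) hkept.update_append (by omega)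
        (by simpa using hk) hlt
      refine ⟨reg₂, mem₂, reach₁.trans reach₂, by simpa [hj] using h₂, by simpa [hj] using hL,
        fun u hu => ?_⟩
      rw [hlabel u hu, Function.update_of_ne (by omega)]
      by_cases huw : u = w <;> simp [huw, hj]

/-! ### The program simulates QECC -/

/-- The configuration `c` represents the state `s` at the head of the main loop; the unclustered
vertices are held in the order `L`. -/
structure AtLoop (s : QState n) (L : List (Fin n)) (c : Config) : Prop where
  pc : c.pc = Target.loop
  regs : LoopRegs n s.budget L.length c.reg
  nodup : L.Nodup
  toFinset : L.toFinset = s.R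
  list : ListAt c.mem n (L.map Fin.val)
  label : ∀ u : Fin n, c.mem u = if u ∈ s.R then 0 else s.label u + 1
  queries : c.queries = s.queries.map (Sym2.map Fin.val)

section Simulation

variable {L : List (Fin n)} {c : Config} {u v : Fin n}

theorem AtLoop.length_eq (h : AtLoop s L c) : L.length = #s.R := by
  rw [← h.toFinset, List.toFinset_card_of_nodup h.nodup]

theorem AtLoop.mem_iff (h : AtLoop s L c) : u ∈ L ↔ u ∈ s.R := by
  rw [← h.toFinset, List.mem_toFinset]

theorem AtLoop.mem_add_idxOf (h : AtLoop s L c) (hv : v ∈ s.R) : c.mem (n + L.idxOf v) = v := by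
  have hlt : L.idxOf v < L.length := List.idxOf_lt_length_of_mem (h.mem_iff.2 hv)
  exact (h.list (L.idxOf v) (by simpa using hlt)).trans (by simp)

theorem joins_edgeOracle_iff {R : Finset (Fin n)} (hu : u ∈ R) :
    Joins (edgeOracle G) v u ↔ u ∈ pivotCluster G R v := by
  rw [Joins, edgeOracle_pos_iff, Fin.val_inj, mem_pivotCluster_of_mem hu]

theorem scanQueries_map_val {R : Finset (Fin n)} (hL : L.Nodup) (hLR : L.toFinset = R)
    (v : Fin n) :
    scanQueries v (L.map Fin.val) =
      ((R.erase v).val.map fun w => s(v, w)).map (Sym2.map Fin.val) := by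
  have erase_eq : R.erase v = (L.filter fun u => u ≠ v).toFinset := by
    rw [List.toFinset_filter, hLR]
    ext u
    simp [and_comm]
  rw [erase_eq, List.toFinset_val, (hL.filter _).dedup, Multiset.map_map, Multiset.map_coe,
    scanQueries, List.filter_map, List.map_map]
  simp [Function.comp_def, Fin.val_inj]

open Classical in
theorem AtLoop.reaches_pivotRound {reg : ℕ → ℕ} (h : AtLoop s L c) (hv : v ∈ s.R)
    (hreg : ScanRegs n (pivotRound G s v).budget L.length v 0 0 reg) :
    ∃ c', Reaches qeccProgram (edgeOracle G) (12 * #s.R + 3)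
        ⟨Target.scan, reg, c.mem, c.queries⟩ c' ∧
      AtLoop (pivotRound G s v) (L.filter (· ∉ pivotCluster G s.R v)) c' := by
  obtain ⟨reg₁, mem, reach₁, hreg₁, hlist, hlabel⟩ :=
    hreg.reaches_scan_end (O := edgeOracle G) (q := c.queries) (kept := []) h.list listAt_nil
      (by simp) le_rfl (by simp)
  obtain ⟨reg₂, reach₂, hreg₂⟩ := hreg₁.reaches_loop
  have filter_eq : (L.map Fin.val).filter (¬ Joins (edgeOracle G) v ·) =
      (L.filter (· ∉ pivotCluster G s.R v)).map Fin.val := by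
    rw [List.filter_map]
    refine congrArg _ (List.filter_congr fun u hu => ?_)
    simp [joins_edgeOracle_iff (h.mem_iff.1 hu)]
  rw [List.nil_append, filter_eq] at hreg₂ hlist
  rw [List.length_map, h.length_eq] at reach₁
  refine ⟨_, reach₁.trans reach₂, rfl, by simpa using hreg₂, h.nodup.filter _, ?_, hlist, ?_, ?_⟩
  · ext u
    simp [pivotRound, h.mem_iff]
  · intro u
    by_cases hu : u ∈ s.R
    · by_cases hC : u ∈ pivotCluster G s.R v <;>
        simp [hlabel, h.label, h.mem_iff, pivotRound, joins_edgeOracle_iff hu, hu, hC, Fin.val_inj]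
    · have hC : u ∉ pivotCluster G s.R v := fun hC => hu (pivotCluster_subset hv hC)
      simp [hlabel, h.label, h.mem_iff, pivotRound, hu, hC, Fin.val_inj]
  · simp [pivotRound, scanQueries_map_val h.nodup h.toFinset, h.queries, add_comm]

theorem AtLoop.run_round (h : AtLoop s L c) (hs : s.Continues) :
    ∃ F : s.R → Config, run qeccProgram (edgeOracle G) 10 c =
        (PMF.uniformOfFinset s.R.attach (Finset.attach_nonempty_iff.2 hs.1)).map F ∧
      ∀ v, ∃ L' c', Reaches qeccProgram (edgeOracle G) (12 * #s.R + 3) (F v) c' ∧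
        AtLoop (pivotRound G s v) L' c' := by
  obtain ⟨pc, reg, mem, q⟩ := c
  obtain rfl : pc = Target.loop := h.pc
  have hlen := h.length_eq
  have mem_eq : ∀ v ∈ s.R, mem (n + L.idxOf v) = v := fun v hv => h.mem_add_idxOf hv
  obtain ⟨F, run_eq, hF⟩ := h.regs.run_round (O := edgeOracle G) (mem := mem) (q := q)
    (hlen ▸ hs.1.card_pos) (hlen ▸ hs.2)
  refine ⟨fun v => ⟨Target.scan, F (L.idxOf v.1), mem, q⟩, ?_, fun v => ?_⟩
  · rw [run_eq, uniformBelow_length h.nodup h.toFinset (Finset.attach_nonempty_iff.2 hs.1),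
      PMF.map_comp]
    rfl
  · have hreg := hF (L.idxOf v.1)
    rw [mem_eq v v.2, hlen] at hreg
    exact ⟨_, h.reaches_pivotRound v.2 (hlen ▸ hreg)⟩

/-- What the machine outputs: the clustering and the queries. -/
def Config.outcome (n : ℕ) (c : Config) : (Fin n → ℕ) × Multiset (Sym2 ℕ) :=
  (c.clustering n, c.queries)

/-- What the algorithm outputs: the clustering and the queries. -/
def QState.outcome (s : QState n) : (Fin n → ℕ) × Multiset (Sym2 ℕ) :=
  (s.output, s.queries.map (Sym2.map Fin.val))

theorem Config.outcome_eq (hl : ∀ u : Fin n, c.mem u = if u ∈ s.R then 0 else s.label u + 1)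
    (hq : c.queries = s.queries.map (Sym2.map Fin.val)) : c.outcome n = s.outcome := by
  refine Prod.ext (funext fun u => ?_) hq
  simp only [Config.outcome, QState.outcome, Config.clustering, QState.output, hl]
  split_ifs <;> simp_all

theorem halted_exit (reg mem : ℕ → ℕ) (q : Multiset (Sym2 ℕ)) :
    Halted qeccProgram ⟨Target.exit, reg, mem, q⟩ :=
  le_refl 37

theorem AtLoop.outputs_of_not_continues (O : ℕ → ℕ → ℕ) (h : AtLoop s L c)
    (hs : ¬ s.Continues) :
    Outputs qeccProgram O (Config.outcome n) 3 c (PMF.pure s.outcome) := by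
  obtain ⟨pc, reg, mem, q⟩ := c
  obtain rfl : pc = Target.loop := h.pc
  have exhausted : L.length = 0 ∨ s.budget < L.length - 1 := by
    rw [h.length_eq, Finset.card_eq_zero, ← Finset.not_nonempty_iff_eq_empty]
    exact (not_and_or.1 hs).imp_right not_le.1
  obtain ⟨reg', reach⟩ := h.regs.reaches_exit (O := O) (mem := mem) (q := q) exhausted
  rw [← Config.outcome_eq h.label h.queries]
  exact .of_reaches reach (.of_halted (T := 0) (halted_exit reg' mem q))

/-- A bound for the running time of the main loop from the state `s` on. A round on `r` vertices
takes at most `12 * r + 13` steps and uses `r - 1` of the budget; since `r ≤ 2 * (r - 1)` unless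
`r = 1`, this is at most `37 * (r - 1)`, except for a last round on a single vertex. -/
def QState.timeLeft (s : QState n) : ℕ :=
  37 * s.budget + (if #s.R = 0 then 0 else 25) + 3

theorem QState.timeLeft_le (s : QState n) : s.timeLeft ≤ 37 * s.budget + 28 := by
  rw [QState.timeLeft]
  split_ifs <;> omega

theorem QState.timeLeft_pivotRound (hs : s.Continues) (hv : v ∈ s.R) :
    10 + (12 * #s.R + 3 + (pivotRound G s v).timeLeft) ≤ s.timeLeft := by
  have card_pos := hs.1.card_pos
  have le_budget := hs.2
  have card_lt := pivotRound_card_lt G s hv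
  have budget_eq : (pivotRound G s v).budget = s.budget - (#s.R - 1) := rfl
  simp only [QState.timeLeft, budget_eq]
  split_ifs <;> omega

theorem AtLoop.outputs (h : AtLoop s L c) :
    Outputs qeccProgram (edgeOracle G) (Config.outcome n) s.timeLeft c
      ((qeccLoop G s).map QState.outcome) := by
  induction s using QState.loop_induction G generalizing L c with
  | halt s hs =>
    rw [qeccLoop_of_not_continues hs, PMF.pure_map]
    exact (h.outputs_of_not_continues _ hs).mono (Nat.le_add_left _ _)
  | round s hs ih =>
    obtain ⟨F, run_eq, hF⟩ := h.run_round (G := G) hs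
    rw [qeccLoop_of_continues hs, PMF.map_bind]
    refine (Outputs.of_run_eq_map (T := s.timeLeft - 10) run_eq fun v _ => ?_).mono ?_
    · obtain ⟨L', c', reach, h'⟩ := hF v
      have := QState.timeLeft_pivotRound (G := G) hs v.2
      exact (Outputs.of_reaches reach (ih v v.2 h')).mono (by omega)
    · obtain ⟨v, hv⟩ := hs.1
      have := QState.timeLeft_pivotRound (G := G) hs hv
      omega

theorem reaches_listed (O : ℕ → ℕ → ℕ) {Q i : ℕ} (h : n ≤ Q + 1) (hi : i ≤ n) :
    ∃ reg mem, Reaches qeccProgram O (4 + 5 * i) (start n Q) ⟨Target.list, reg, mem, 0⟩ ∧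
      LoopRegs n Q i reg ∧ ListAt mem n (List.range i) ∧ ∀ u < n, mem u = 0 := by
  induction i with
  | zero =>
    obtain ⟨reg, reach, hreg⟩ := reaches_list (O := O) (reg := (start n Q).reg)
      (mem := (start n Q).mem) (q := 0) h rfl
    exact ⟨reg, _, reach, hreg, listAt_nil, fun _ _ => rfl⟩
  | succ i ih =>
    obtain ⟨reg, mem, reach, hreg, hlist, hmem⟩ := ih (Nat.le_of_succ_le hi)
    obtain ⟨reg', reach', hreg'⟩ := hreg.reaches_listVertex (O := O) (mem := mem) (q := 0) hi
    refine ⟨reg', _, reach.trans reach', hreg', ?_, fun u hu => ?_⟩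
    · rw [List.range_succ]
      simpa using hlist.update_append (x := i)
    · rw [Function.update_of_ne (by omega), hmem u hu]

theorem reaches_atLoop_initial (O : ℕ → ℕ → ℕ) {Q : ℕ} (h : n ≤ Q + 1) :
    ∃ c, Reaches qeccProgram O (4 + 5 * n + 2) (start n Q) c ∧
      AtLoop (QState.initial n Q) (List.finRange n) c := by
  obtain ⟨reg, mem, reach, hreg, hlist, hmem⟩ := reaches_listed O h le_rfl
  refine ⟨_, reach.trans hreg.reaches_loop, rfl, ?_, List.nodup_finRange n, ?_, ?_, ?_, ?_⟩
  · rwa [List.length_finRange]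
  · simp [QState.initial]
  · rwa [List.map_coe_finRange_eq_range]
  · simp [QState.initial, hmem]
  · simp [QState.initial]

theorem outputs_start_of_lt (G : SimpleGraph (Fin n)) {Q : ℕ} (h : Q + 1 < n) :
    Outputs qeccProgram (edgeOracle G) (Config.outcome n) 3 (start n Q)
      ((qeccLoop G (QState.initial n Q)).map QState.outcome) := by
  obtain ⟨reg, reach⟩ := reaches_exit_of_lt (O := edgeOracle G) (reg := (start n Q).reg)
    (mem := (start n Q).mem) (q := 0) h
  have too_large : ¬ (QState.initial n Q).Continues := fun hs => by
    have := hs.2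
    simp only [QState.initial, Finset.card_univ, Fintype.card_fin] at this
    omega
  rw [qeccLoop_of_not_continues too_large, PMF.pure_map,
    ← Config.outcome_eq (c := ⟨Target.exit, reg, (start n Q).mem, 0⟩)
      (by simp [QState.initial, start]) rfl]
  exact .of_reaches reach (.of_halted (T := 0) (halted_exit _ _ _))

theorem implementsQECC_qeccProgram : ImplementsQECC qeccProgram fun _ Q => 81 * Q := by
  intro n Q hQ G
  have outcome_eq : (qecc G Q).map (fun r => (r.1, r.2.map (Sym2.map Fin.val))) =
      (qeccLoop G (QState.initial n Q)).map QState.outcome := by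
    rw [qecc_eq_map, PMF.map_comp]
    rfl
  rw [outcome_eq]
  change Outputs qeccProgram (edgeOracle G) (Config.outcome n) (81 * Q) (start n Q) _
  obtain h | h := le_or_gt n (Q + 1)
  · obtain ⟨c, reach, hc⟩ := reaches_atLoop_initial (edgeOracle G) h
    have time_le : (QState.initial n Q).timeLeft ≤ 37 * Q + 28 := QState.timeLeft_le _
    exact (Outputs.of_reaches reach hc.outputs).mono (by omega)
  · exact (outputs_start_of_lt G h).mono (by omega)

end Simulation

end CorrClust

theorem theorem1 :
    (∀ (n Q : ℕ), 0 < Q → ∀ G : SimpleGraph (Fin n),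
      (∀ r ∈ (CorrClust.qecc G Q).support, Multiset.card r.2 ≤ Q) ∧
      CorrClust.expect (CorrClust.qecc G Q) (fun r => (CorrClust.cost G r.1 : ENNReal)) ≤
        3 * (CorrClust.opt G : ENNReal) + (n : ENNReal) ^ 3 / (2 * (Q : ENNReal))) ∧
    ∃ (P : List CorrClust.Instr) (C : ℕ),
      CorrClust.ImplementsQECC P (fun _ Q => C * Q) :=
  ⟨fun _ Q hQ G => ⟨CorrClust.card_queries_le G Q, CorrClust.expect_cost_qecc_le G hQ⟩,
    CorrClust.qeccProgram, 81, CorrClust.implementsQECC_qeccProgram⟩
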